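/- Let $\alpha\in(0,1)$ and $L=[-1,-\alpha]\cup\{\alpha\}$. For a positive integer $d$, let $N_L(d)$ denote the maximum size of a spherical $L$-code in $\mathbb{R}^d$, that is, of a set of unit vectors in $\mathbb{R}^d$ such that the inner product of any two distinct vectors in the set belongs to $L$. Then there exists a positive integer $d_0=d_0(\alpha)$ such that for all $d\ge d_0$, $$N_L(d)\le 4(d-1).$$ -/

import Mathlib

/-- A spherical `L`-code in `ℝ^d`: a set of unit vectors whose pairwise inner products
(of distinct vectors) lie in `L`. -/
structure IsSphericalCode (L : Set ℝ) {d : ℕ} (C : Set (EuclideanSpace ℝ (Fin d))) : Prop where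
  norm_eq_one : ∀ x ∈ C, ‖x‖ = 1
  inner_mem : ∀ x ∈ C, ∀ y ∈ C, x ≠ y → inner ℝ x y ∈ L

/-- The maximum size `N_L(d)` of a spherical `L`-code in `ℝ^d`, with value in `ℕ∞`, so that it is
`⊤` (and not a junk value) if there were codes of unbounded or infinite size. -/
noncomputable def maxCodeSize (L : Set ℝ) (d : ℕ) : ℕ∞ :=
  ⨆ (C : Set (EuclideanSpace ℝ (Fin d))) (_ : IsSphericalCode L C), C.encard

/-! Call two code vectors adjacent when their inner product is at most -α. Cliques of this graph
have bounded size, so by Ramsey a large code contains t vectors with all inner products α; their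
mean y has square norm close to α. Each code vector is adjacent to only a few of these vectors or
has inner product α with only a few (`not_both_large`), so its inner product with y or with -y is at
least about α. This covers the code by two clusters. Within each, `not_large_independent_negative`
and Ramsey bound the degrees, and it remains to bound a cluster by 2(d-1).

The Gram matrix of a cluster of n vectors is (1-α)I + αJ - A, with A nonnegative, symmetric and of
bounded degree. Thus A is at most 1-α on zero-sum vectors, zero-sum kernel vectors are
(1-α)-eigenvectors of A, and n is at most d plus the kernel dimension. If A is at most 1-α
everywhere, then 1-α can only be the top eigenvalue, with multiplicity at most n/2; a Perron-type
argument shows that the kernel misses one more dimension, so n ≤ 2(d-1).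

Otherwise the multiplicity is bounded or at most 2n/5 (`exists_finrank_zeroSumEigenspace_le`), which
is better for large d. If the form exceeds 1-α on a ball of fixed radius, an eigenvector vanishing
on a slightly larger ball is zero. If not, requiring eigenvectors to vanish on a net of at most n/3
points truncates the matrix; every three steps of it lose a fixed factor, which leaves multiplicity
at most n/15. -/

open Matrix

/-! ### Quadratic forms of nonnegative symmetric matrices -/

section SpectralMultiplicity

variable {ι : Type*} [Fintype ι]

theorem dotProduct_abs_self_abs (x : ι → ℝ) : |x| ⬝ᵥ |x| = x ⬝ᵥ x := by
  simp [dotProduct]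

theorem abs_quadForm_le {A : Matrix ι ι ℝ} (hA : ∀ i j, 0 ≤ A i j) (x : ι → ℝ) :
    |x ⬝ᵥ A *ᵥ x| ≤ |x| ⬝ᵥ A *ᵥ |x| := by
  simp only [dotProduct, mulVec]
  refine (Finset.abs_sum_le_sum_abs _ _).trans (Finset.sum_le_sum fun i _ => ?_)
  rw [abs_mul, Pi.abs_apply]
  refine mul_le_mul_of_nonneg_left ?_ (abs_nonneg _)
  refine (Finset.abs_sum_le_sum_abs _ _).trans (Finset.sum_le_sum fun j _ => ?_)
  rw [abs_mul, abs_of_nonneg (hA i j), Pi.abs_apply]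

/-- On vectors supported in `S` the quadratic form of `A` is at most `c` times the norm square. -/
def FormLEOn (A : Matrix ι ι ℝ) (c : ℝ) (S : Set ι) : Prop :=
  ∀ x : ι → ℝ, (∀ i ∉ S, x i = 0) → x ⬝ᵥ A *ᵥ x ≤ c * (x ⬝ᵥ x)

theorem FormLEOn.mono {A : Matrix ι ι ℝ} {c : ℝ} {S T : Set ι} (h : FormLEOn A c T)
    (hST : S ⊆ T) : FormLEOn A c S :=
  fun x hx => h x fun i hi => hx i fun hi' => hi (hST hi')

theorem FormLEOn.neg_le {A : Matrix ι ι ℝ} (hA : ∀ i j, 0 ≤ A i j) {c : ℝ} {S : Set ι}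
    (h : FormLEOn A c S) {x : ι → ℝ} (hx : ∀ i ∉ S, x i = 0) :
    -(x ⬝ᵥ A *ᵥ x) ≤ c * (x ⬝ᵥ x) := by
  have h1 := h |x| (fun i hi => by simp [hx i hi])
  rw [dotProduct_abs_self_abs] at h1
  linarith [neg_abs_le (x ⬝ᵥ A *ᵥ x), abs_quadForm_le hA x]

theorem dotProduct_mulVec_comm {A : Matrix ι ι ℝ} (hA : A.IsSymm) (x y : ι → ℝ) :
    x ⬝ᵥ A *ᵥ y = y ⬝ᵥ A *ᵥ x := by
  rw [dotProduct_comm, ← vecMul_transpose, hA.eq, dotProduct_mulVec]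

theorem quadForm_add_smul {A : Matrix ι ι ℝ} (hA : A.IsSymm) (x y : ι → ℝ) (s t : ℝ) :
    (s • x + t • y) ⬝ᵥ A *ᵥ (s • x + t • y) =
      s ^ 2 * (x ⬝ᵥ A *ᵥ x) + 2 * s * t * (x ⬝ᵥ A *ᵥ y) + t ^ 2 * (y ⬝ᵥ A *ᵥ y) := by
  simp only [mulVec_add, mulVec_smul, add_dotProduct, dotProduct_add, smul_dotProduct,
    dotProduct_smul, smul_eq_mul, dotProduct_mulVec_comm hA y x]
  ring

theorem dotProduct_add_smul_self (x y : ι → ℝ) (s t : ℝ) :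
    (s • x + t • y) ⬝ᵥ (s • x + t • y) =
      s ^ 2 * (x ⬝ᵥ x) + 2 * s * t * (x ⬝ᵥ y) + t ^ 2 * (y ⬝ᵥ y) := by
  simp only [add_dotProduct, dotProduct_add, smul_dotProduct,
    dotProduct_smul, smul_eq_mul, dotProduct_comm y x]
  ring

/-- On `S` the forms of c - B and c + B are both nonnegative, the latter by `FormLEOn.neg_le`.
Evaluating the first at Bz + cz and the second at Bz - cz and adding leaves exactly the claim. -/
theorem FormLEOn.mulVec_le {B : Matrix ι ι ℝ} (hs : B.IsSymm) (hB : ∀ i j, 0 ≤ B i j) {c : ℝ}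
    (hc : 0 < c) {S : Set ι} (h : FormLEOn B c S) {z : ι → ℝ} (hz : ∀ i ∉ S, z i = 0)
    (hBz : ∀ i ∉ S, (B *ᵥ z) i = 0) :
    (B *ᵥ z) ⬝ᵥ (B *ᵥ z) ≤ c ^ 2 * (z ⬝ᵥ z) := by
  have hsupp (t : ℝ) : ∀ i ∉ S, ((1 : ℝ) • (B *ᵥ z) + t • z) i = 0 := fun i hi => by
    simp [hz i hi, hBz i hi]
  have h1 := h _ (hsupp c)
  have h2 := h.neg_le hB (hsupp (-c))
  rw [quadForm_add_smul hs, dotProduct_add_smul_self] at h1 h2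
  have h3 : 0 ≤ c * (c ^ 2 * (z ⬝ᵥ z) - (B *ᵥ z) ⬝ᵥ (B *ᵥ z)) := by nlinarith
  have := nonneg_of_mul_nonneg_right h3 hc
  linarith

/-- A form bounded on zero-sum vectors which is exceeded somewhere on `S` is strictly bounded away
from the neighbourhood of `S`. -/
theorem eq_zero_of_far {A : Matrix ι ι ℝ} (hs : A.IsSymm) (hA : ∀ i j, 0 ≤ A i j) {c : ℝ}
    (h0 : ∀ x : ι → ℝ, ∑ i, x i = 0 → x ⬝ᵥ A *ᵥ x ≤ c * (x ⬝ᵥ x)) {x z : ι → ℝ}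
    (hx : c * (x ⬝ᵥ x) < x ⬝ᵥ A *ᵥ x) (hz : c * (z ⬝ᵥ z) ≤ z ⬝ᵥ A *ᵥ z)
    (hdisj : ∀ i, x i = 0 ∨ z i = 0) (hfar : ∀ i j, x i = 0 ∨ A i j = 0 ∨ z j = 0) : z = 0 := by
  have hx' : c * (|x| ⬝ᵥ |x|) < |x| ⬝ᵥ A *ᵥ |x| := by
    rw [dotProduct_abs_self_abs]
    exact hx.trans_le ((le_abs_self _).trans (abs_quadForm_le hA x))
  have hz' : c * (|z| ⬝ᵥ |z|) ≤ |z| ⬝ᵥ A *ᵥ |z| := by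
    rw [dotProduct_abs_self_abs]
    exact hz.trans ((le_abs_self _).trans (abs_quadForm_le hA z))
  have hxz : |x| ⬝ᵥ |z| = 0 := by
    refine Finset.sum_eq_zero fun i _ => ?_
    rcases hdisj i with h | h <;> simp [h]
  have hxAz : |x| ⬝ᵥ A *ᵥ |z| = 0 := by
    refine Finset.sum_eq_zero fun i _ => ?_
    by_cases h : x i = 0
    · simp [h]
    · refine mul_eq_zero_of_right _ (Finset.sum_eq_zero fun j _ => ?_)
      rcases hfar i j with h' | h' | h' <;> simp_all
  set a := ∑ i, |z| i with ha
  set e := ∑ i, |x| i with he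
  -- The weights make the combination zero-sum, and the cross terms vanish by the support
  -- conditions, so the strict excess at `x` forces `a = 0`.
  have key := h0 (a • |x| + (-e) • |z|) (by
    simp only [Pi.add_apply, Pi.smul_apply, smul_eq_mul, Finset.sum_add_distrib,
      ← Finset.mul_sum, ← ha, ← he]
    ring)
  rw [quadForm_add_smul hs, dotProduct_add_smul_self, hxz, hxAz] at key
  have ha0 : a = 0 := by
    by_contra hne
    have : 0 < a ^ 2 := by positivity
    nlinarith [sq_nonneg e]
  have := (Finset.sum_eq_zero_iff_of_nonneg (fun i _ => by simp)).1 ha0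
  funext i
  simpa using this i (Finset.mem_univ i)

/-- If the form of `A` is globally at most `c`, then `c`-eigenvectors are stable under absolute
values. -/
theorem FormLEOn.mulVec_abs_eq {A : Matrix ι ι ℝ} (hs : A.IsSymm) (hA : ∀ i j, 0 ≤ A i j)
    {c : ℝ} (h : FormLEOn A c Set.univ) {x : ι → ℝ} (hx : A *ᵥ x = c • x) :
    A *ᵥ |x| = c • |x| := by
  classical
  have h1 : c * (|x| ⬝ᵥ |x|) ≤ |x| ⬝ᵥ A *ᵥ |x| := by
    have := (le_abs_self _).trans (abs_quadForm_le hA x)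
    rwa [hx, dotProduct_smul, smul_eq_mul, ← dotProduct_abs_self_abs] at this
  set y := |x|
  set w := A *ᵥ y - c • y with hw
  -- `|x|` attains the maximum `c` of the Rayleigh quotient, so the first variation in direction `w`
  -- vanishes.
  have key (t : ℝ) : 2 * t * (w ⬝ᵥ w) + t ^ 2 * (w ⬝ᵥ A *ᵥ w - c * (w ⬝ᵥ w)) ≤ 0 := by
    have h2 := h ((1 : ℝ) • y + t • w) (by simp)
    rw [quadForm_add_smul hs, dotProduct_add_smul_self, dotProduct_mulVec_comm hs y w] at h2
    have h3 : w ⬝ᵥ w = w ⬝ᵥ A *ᵥ y - c * (y ⬝ᵥ w) := by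
      conv_lhs => rw [hw, sub_dotProduct, ← hw]
      rw [smul_dotProduct, smul_eq_mul, dotProduct_comm w (A *ᵥ y)]
    linear_combination h2 + h1 + 2 * t * h3
  have hww : w ⬝ᵥ w = 0 := by
    have hnn : 0 ≤ w ⬝ᵥ w := Finset.sum_nonneg fun i _ => mul_self_nonneg _
    by_contra hne
    have hpos : 0 < w ⬝ᵥ w := lt_of_le_of_ne hnn (Ne.symm hne)
    set g := w ⬝ᵥ A *ᵥ w - c * (w ⬝ᵥ w)
    have h4 := key ((w ⬝ᵥ w) / (|g| + 1))
    have hg : 0 < |g| + 1 := by positivity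
    have h5 : 2 * ((w ⬝ᵥ w) / (|g| + 1)) * (w ⬝ᵥ w) + ((w ⬝ᵥ w) / (|g| + 1)) ^ 2 * g
        = (w ⬝ᵥ w) ^ 2 / (|g| + 1) ^ 2 * (2 * (|g| + 1) + g) := by field_simp
    rw [h5] at h4
    have : 0 < (w ⬝ᵥ w) ^ 2 / (|g| + 1) ^ 2 * (2 * (|g| + 1) + g) := by
      have : 0 < 2 * (|g| + 1) + g := by linarith [neg_abs_le g, abs_nonneg g]
      positivity
    linarith
  have : w = 0 := dotProduct_self_eq_zero.1 hww
  exact sub_eq_zero.1 this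

end SpectralMultiplicity

/-! ### Bounds on eigenspace dimensions -/

section EigenspaceDimension

variable {ι : Type*} [Fintype ι]

theorem finrank_le_card_add_finrank_inf (V : Submodule ℝ (ι → ℝ)) (D : Finset ι) :
    Module.finrank ℝ V ≤ D.card + Module.finrank ℝ
      (V ⊓ LinearMap.ker (LinearMap.funLeft ℝ ℝ (fun i : D => (i : ι))) : Submodule ℝ (ι → ℝ)) := by
  set g := LinearMap.funLeft ℝ ℝ (fun i : D => (i : ι))
  have h1 := Submodule.finrank_sup_add_finrank_inf_eq V (LinearMap.ker g)
  have h2 := LinearMap.finrank_range_add_finrank_ker g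
  have h3 : Module.finrank ℝ (LinearMap.range g) ≤ D.card := by
    simpa using Submodule.finrank_le (LinearMap.range g)
  have h4 := Submodule.finrank_le (V ⊔ LinearMap.ker g)
  omega

theorem finrank_le_card_of_vanishing {V : Submodule ℝ (ι → ℝ)} (D : Finset ι)
    (h : ∀ x ∈ V, (∀ i ∈ D, x i = 0) → x = 0) : Module.finrank ℝ V ≤ D.card := by
  have h1 := finrank_le_card_add_finrank_inf V D
  have h2 : V ⊓ LinearMap.ker (LinearMap.funLeft ℝ ℝ (fun i : D => (i : ι))) = ⊥ := by
    rw [eq_bot_iff]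
    rintro x ⟨hx, hx'⟩
    refine h x hx fun i hi => ?_
    exact congrFun hx' ⟨i, hi⟩
  rw [h2, finrank_bot] at h1
  simpa using h1

/-- By the stability of eigenvectors under absolute values, a zero of an eigenvector spreads to its
neighbours. Hence an eigenvector is determined on a maximal independent set, and by the eigenvalue
equation also on its complement; the smaller of the two has at most half the indices. -/
theorem two_mul_finrank_eigenspace_le {A : Matrix ι ι ℝ} (hs : A.IsSymm)
    (hA : ∀ i j, 0 ≤ A i j) (hd : ∀ i, A i i = 0) {c : ℝ} (hc : 0 < c)
    (h : FormLEOn A c Set.univ) :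
    2 * Module.finrank ℝ (Module.End.eigenspace A.mulVecLin c) ≤ Fintype.card ι := by
  classical
  have hprop : ∀ x ∈ Module.End.eigenspace A.mulVecLin c, ∀ i, x i = 0 →
      ∀ j, A i j ≠ 0 → x j = 0 := by
    intro x hx i hi j hij
    have hx' : A *ᵥ x = c • x := Module.End.mem_eigenspace_iff.1 hx
    have h1 := congrFun (h.mulVec_abs_eq hs hA hx') i
    simp only [mulVec, dotProduct, Pi.smul_apply, Pi.abs_apply, hi, abs_zero, smul_zero] at h1
    have h2 := (Finset.sum_eq_zero_iff_of_nonneg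
      (fun j _ => mul_nonneg (hA i j) (abs_nonneg _))).1 h1 j (Finset.mem_univ j)
    simpa [hij] using h2
  obtain ⟨D, hD, hmax⟩ := Finset.exists_max_image
    (Finset.univ.filter fun D : Finset ι => ∀ i ∈ D, ∀ j ∈ D, A i j = 0) Finset.card
    ⟨∅, by simp⟩
  simp only [Finset.mem_filter, Finset.mem_univ, true_and] at hD hmax
  have hdom : ∀ i ∉ D, ∃ j ∈ D, A i j ≠ 0 := by
    intro i hi
    by_contra! hcon
    have := hmax (insert i D) (by
      intro a ha b hb
      rcases Finset.mem_insert.1 ha with ha' | ha' <;>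
        rcases Finset.mem_insert.1 hb with hb' | hb'
      · rw [ha', hb']; exact hd _
      · rw [ha']; exact hcon b hb'
      · rw [hb', hs.apply]; exact hcon a ha'
      · exact hD a ha' b hb')
    rw [Finset.card_insert_of_notMem hi] at this
    omega
  have h1 : Module.finrank ℝ (Module.End.eigenspace A.mulVecLin c) ≤ D.card := by
    refine finrank_le_card_of_vanishing D fun x hx h0 => funext fun i => ?_
    by_cases hi : i ∈ D
    · exact h0 i hi
    · obtain ⟨j, hj, hij⟩ := hdom i hi
      exact hprop x hx j (h0 j hj) i (by rwa [hs.apply])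
  have h2 : Module.finrank ℝ (Module.End.eigenspace A.mulVecLin c) ≤ Dᶜ.card := by
    refine finrank_le_card_of_vanishing Dᶜ fun x hx h0 => funext fun i => ?_
    have hx' : A *ᵥ x = c • x := Module.End.mem_eigenspace_iff.1 hx
    by_cases hi : i ∈ D
    · have h3 := congrFun hx' i
      have h4 : (A *ᵥ x) i = 0 := Finset.sum_eq_zero fun j _ => by
        by_cases hj : j ∈ D
        · simp [hD i hi j hj]
        · simp [h0 j (by simpa using hj)]
      rw [h4, Pi.smul_apply, smul_eq_mul] at h3
      simpa [hc.ne'] using h3.symm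
    · exact h0 i (by simpa using hi)
  have := Finset.card_add_card_compl D
  omega

/-- A trace bound on S²: Bessel's inequality for each column of `S` against an orthonormal basis of
`V`, summed over the columns. -/
theorem finrank_mul_sq_le_sum_sq [DecidableEq ι] {S : Matrix ι ι ℝ} (hs : S.IsSymm) {ν : ℝ}
    {V : Submodule ℝ (ι → ℝ)} (hV : ∀ x ∈ V, S *ᵥ x = ν • x) :
    Module.finrank ℝ V * ν ^ 2 ≤
      ∑ i, (S *ᵥ Pi.single i 1) ⬝ᵥ (S *ᵥ Pi.single i 1) := by
  let e := (WithLp.linearEquiv 2 ℝ (ι → ℝ)).symm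
  let V' : Submodule ℝ (EuclideanSpace ℝ ι) := V.map e.toLinearMap
  have hfin : Module.finrank ℝ V' = Module.finrank ℝ V := LinearEquiv.finrank_map_eq e V
  let u := stdOrthonormalBasis ℝ V'
  have hu : Orthonormal ℝ (fun l => (u l : EuclideanSpace ℝ ι)) :=
    u.orthonormal.comp_linearIsometry V'.subtypeₗᵢ
  have hinner (i : ι) (l) : inner ℝ (u l : EuclideanSpace ℝ ι) (e (S *ᵥ Pi.single i 1))
      = ν * (u l : EuclideanSpace ℝ ι) i := by
    obtain ⟨x, hx, hxe⟩ := (u l).2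
    rw [← hxe]
    have : inner ℝ (e x) (e (S *ᵥ Pi.single i 1)) = x ⬝ᵥ S *ᵥ Pi.single i 1 := by
      simp [e, PiLp.inner_apply, dotProduct, mul_comm]
    refine this.trans ?_
    rw [dotProduct_mulVec_comm hs, hV x hx]
    simp [e]
  have hb (i : ι) : ∑ l, (ν * (u l : EuclideanSpace ℝ ι) i) ^ 2 ≤
      (S *ᵥ Pi.single i 1) ⬝ᵥ (S *ᵥ Pi.single i 1) := by
    have h1 := hu.sum_inner_products_le (e (S *ᵥ Pi.single i 1)) (s := Finset.univ)
    have h2 : ‖e (S *ᵥ Pi.single i 1)‖ ^ 2 = (S *ᵥ Pi.single i 1) ⬝ᵥ (S *ᵥ Pi.single i 1) := by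
      rw [EuclideanSpace.norm_sq_eq]
      simp [e, dotProduct, sq]
    rw [h2] at h1
    refine le_trans (le_of_eq ?_) h1
    refine Finset.sum_congr rfl fun l _ => ?_
    rw [hinner, Real.norm_eq_abs, sq_abs]
  refine le_trans (le_of_eq ?_) (Finset.sum_le_sum fun i _ => hb i)
  rw [Finset.sum_comm]
  have h3 (l) : ∑ i, (ν * (u l : EuclideanSpace ℝ ι) i) ^ 2 = ν ^ 2 := by
    have h4 : ‖(u l : EuclideanSpace ℝ ι)‖ = 1 := hu.1 l
    have h5 := EuclideanSpace.norm_sq_eq (u l : EuclideanSpace ℝ ι)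
    rw [h4] at h5
    simp only [Real.norm_eq_abs, sq_abs] at h5
    simp_rw [mul_pow]
    rw [← Finset.mul_sum, ← h5]
    ring
  simp_rw [h3]
  simp [hfin]

end EigenspaceDimension

/-! ### Truncation of a matrix to a set of indices -/

section Truncate

variable {ι : Type*}

open Classical in
/-- The matrix `B` with all rows and columns outside `W` replaced by zero. -/
noncomputable def truncate (B : Matrix ι ι ℝ) (W : Finset ι) : Matrix ι ι ℝ :=
  Matrix.of fun i j => if i ∈ W ∧ j ∈ W then B i j else 0

theorem truncate_isSymm {B : Matrix ι ι ℝ} (hs : B.IsSymm) (W : Finset ι) :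
    (truncate B W).IsSymm := by
  ext i j
  by_cases hi : i ∈ W <;> by_cases hj : j ∈ W <;> simp [truncate, hi, hj, hs.apply]

theorem truncate_nonneg {B : Matrix ι ι ℝ} (hB : ∀ i j, 0 ≤ B i j) (W : Finset ι) (i j : ι) :
    0 ≤ truncate B W i j := by
  simp only [truncate, of_apply]
  split_ifs
  exacts [hB i j, le_rfl]

theorem truncate_le {B : Matrix ι ι ℝ} (hB : ∀ i j, 0 ≤ B i j) (W : Finset ι) (i j : ι) :
    truncate B W i j ≤ B i j := by
  simp only [truncate, of_apply]
  split_ifs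
  exacts [le_rfl, hB i j]

end Truncate

/-! ### Norm loss of powers of the truncated matrix -/

section Decay

variable {ι : Type*} [Fintype ι]

open Classical in
/-- The set of indices reachable from `S` through one nonzero entry of `B`. -/
noncomputable def nbhd (B : Matrix ι ι ℝ) (S : Finset ι) : Finset ι :=
  Finset.univ.filter fun j => ∃ i ∈ S, B i j ≠ 0

theorem mem_nbhd {B : Matrix ι ι ℝ} {S : Finset ι} {j : ι} :
    j ∈ nbhd B S ↔ ∃ i ∈ S, B i j ≠ 0 := by
  simp [nbhd]

theorem nbhd_mono {B : Matrix ι ι ℝ} {S T : Finset ι} (h : S ⊆ T) : nbhd B S ⊆ nbhd B T := by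
  intro j hj
  obtain ⟨i, hi, hij⟩ := mem_nbhd.1 hj
  exact mem_nbhd.2 ⟨i, h hi, hij⟩

theorem subset_nbhd {B : Matrix ι ι ℝ} (hd : ∀ i, B i i ≠ 0) (S : Finset ι) : S ⊆ nbhd B S :=
  fun i hi => mem_nbhd.2 ⟨i, hi, hd i⟩

theorem card_nbhd_le {B : Matrix ι ι ℝ} {Δ : ℕ} (hΔ : ∀ i, (nbhd B {i}).card ≤ Δ) (S : Finset ι) :
    (nbhd B S).card ≤ S.card * Δ := by
  classical
  have : nbhd B S ⊆ S.biUnion fun i => nbhd B {i} := by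
    intro j hj
    obtain ⟨i, hi, hij⟩ := mem_nbhd.1 hj
    exact Finset.mem_biUnion.2 ⟨i, hi, mem_nbhd.2 ⟨i, by simp, hij⟩⟩
  exact (Finset.card_le_card this).trans (Finset.card_biUnion_le_card_mul _ _ _ fun i _ => hΔ i)

theorem card_iterate_nbhd_le {B : Matrix ι ι ℝ} {Δ : ℕ} (hΔ : ∀ i, (nbhd B {i}).card ≤ Δ) (i : ι)
    (r : ℕ) : ((nbhd B)^[r] {i}).card ≤ Δ ^ r := by
  induction r with
  | zero => simp
  | succ r ih =>
    rw [Function.iterate_succ_apply', pow_succ]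
    exact (card_nbhd_le hΔ _).trans (Nat.mul_le_mul_right _ ih)

theorem iterate_nbhd_mono {B : Matrix ι ι ℝ} (hd : ∀ i, B i i ≠ 0) (S : Finset ι) {r s : ℕ}
    (h : r ≤ s) : (nbhd B)^[r] S ⊆ (nbhd B)^[s] S := by
  induction s, h using Nat.le_induction with
  | base => exact subset_rfl
  | succ s _ ih =>
    rw [Function.iterate_succ_apply']
    exact ih.trans (subset_nbhd hd _)

theorem mulVec_eq_zero_of_notMem_nbhd {B : Matrix ι ι ℝ} (hs : B.IsSymm) {S : Finset ι}
    {z : ι → ℝ} (hz : ∀ i ∉ S, z i = 0) : ∀ i ∉ nbhd B S, (B *ᵥ z) i = 0 := by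
  intro i hi
  refine Finset.sum_eq_zero fun j _ => ?_
  by_cases hj : j ∈ S
  · have : B i j = 0 := by
      by_contra h
      exact hi (mem_nbhd.2 ⟨j, hj, by rwa [hs.apply]⟩)
    simp [this]
  · simp [hz j hj]

theorem mulVec_le_mulVec_of_le {T B : Matrix ι ι ℝ} (hT : ∀ i j, 0 ≤ T i j)
    (hTB : ∀ i j, T i j ≤ B i j) {x y : ι → ℝ} (hx : 0 ≤ x) (hxy : x ≤ y) : T *ᵥ x ≤ B *ᵥ y :=
  fun i => Finset.sum_le_sum fun j _ =>
    mul_le_mul (hTB i j) (hxy j) (hx j) ((hT i j).trans (hTB i j))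

theorem mulVec_nonneg_of_nonneg {T : Matrix ι ι ℝ} (hT : ∀ i j, 0 ≤ T i j)
    {x : ι → ℝ} (hx : 0 ≤ x) : 0 ≤ T *ᵥ x :=
  fun i => Finset.sum_nonneg fun j _ => mul_nonneg (hT i j) (hx j)

theorem truncate_mulVec_of_notMem (B : Matrix ι ι ℝ) {W : Finset ι} (z : ι → ℝ) {i : ι}
    (hi : i ∉ W) : (truncate B W *ᵥ z) i = 0 :=
  Finset.sum_eq_zero fun j _ => by simp [truncate, hi]

theorem truncate_mulVec_of_mem (B : Matrix ι ι ℝ) {W : Finset ι} {z : ι → ℝ}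
    (hz : ∀ i ∉ W, z i = 0) {i : ι} (hi : i ∈ W) : (truncate B W *ᵥ z) i = (B *ᵥ z) i := by
  refine Finset.sum_congr rfl fun j _ => ?_
  by_cases hj : j ∈ W
  · simp [truncate, hi, hj]
  · simp [hz j hj]

/-- Three steps of the truncated matrix lose a definite amount compared to three steps of `B`. -/
theorem truncate_cube_mulVec_le [DecidableEq ι] {B : Matrix ι ι ℝ} (hs : B.IsSymm)
    (hB : ∀ i j, 0 ≤ B i j) (hd : ∀ i, B i i ≠ 0) {μ c : ℝ} (hμ : 0 < μ) (hc : 0 ≤ c)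
    {U W : Finset ι}
    (hUW : Disjoint U W) (hret : ∀ i ∈ W, ∃ u ∈ U, c ≤ (B ^ 3) u i) {S : Finset ι}
    (hS : FormLEOn B μ ((nbhd B)^[3] S)) {z : ι → ℝ} (hz0 : 0 ≤ z) (hzS : ∀ i ∉ S, z i = 0)
    (hzW : ∀ i ∉ W, z i = 0) :
    (truncate B W ^ 3 *ᵥ z) ⬝ᵥ (truncate B W ^ 3 *ᵥ z) ≤ (μ ^ 6 - c ^ 2) * (z ⬝ᵥ z) := by
  set T := truncate B W with hT
  have hcube (M : Matrix ι ι ℝ) : M ^ 3 *ᵥ z = M *ᵥ (M *ᵥ (M *ᵥ z)) := by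
    simp [pow_succ, mulVec_mulVec, Matrix.mul_assoc]
  have hT0 := truncate_nonneg hB W
  have hTB := truncate_le hB W
  have hle : T ^ 3 *ᵥ z ≤ B ^ 3 *ᵥ z := by
    rw [hcube, hcube]
    have h1 := mulVec_nonneg_of_nonneg hT0 hz0
    have h2 := mulVec_nonneg_of_nonneg hT0 h1
    exact mulVec_le_mulVec_of_le hT0 hTB h2 (mulVec_le_mulVec_of_le hT0 hTB h1
      (mulVec_le_mulVec_of_le hT0 hTB hz0 le_rfl))
  have hT3 : 0 ≤ T ^ 3 *ᵥ z := by
    rw [hcube]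
    exact mulVec_nonneg_of_nonneg hT0 (mulVec_nonneg_of_nonneg hT0 (mulVec_nonneg_of_nonneg hT0 hz0))
  have hTW : ∀ i ∉ W, (T ^ 3 *ᵥ z) i = 0 := fun i hi => by
    rw [hcube, hT, truncate_mulVec_of_notMem B _ hi]
  have hB3 : ∀ i j, 0 ≤ (B ^ 3) i j := by
    intro i j
    simp only [pow_succ, pow_zero, one_mul, Matrix.mul_apply]
    exact Finset.sum_nonneg fun k _ =>
      mul_nonneg (Finset.sum_nonneg fun l _ => mul_nonneg (hB _ _) (hB _ _)) (hB _ _)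
  -- the full matrix
  have hfull : (B ^ 3 *ᵥ z) ⬝ᵥ (B ^ 3 *ᵥ z) ≤ μ ^ 6 * (z ⬝ᵥ z) := by
    rw [hcube]
    have hstep (r : ℕ) (hr : r + 1 ≤ 3) (w : ι → ℝ) (hw : ∀ i ∉ (nbhd B)^[r] S, w i = 0) :
        (∀ i ∉ (nbhd B)^[r + 1] S, (B *ᵥ w) i = 0) ∧
          (B *ᵥ w) ⬝ᵥ (B *ᵥ w) ≤ μ ^ 2 * (w ⬝ᵥ w) := by
      have h1 : ∀ i ∉ (nbhd B)^[r + 1] S, (B *ᵥ w) i = 0 := by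
        rw [Function.iterate_succ_apply']
        exact mulVec_eq_zero_of_notMem_nbhd hs hw
      refine ⟨h1, hS.mulVec_le hs hB hμ (fun i hi => hw i fun h => hi ?_)
        (fun i hi => h1 i fun h => hi ?_)⟩
      · exact iterate_nbhd_mono hd S (by omega) h
      · exact iterate_nbhd_mono hd S hr h
    obtain ⟨a1, b1⟩ := hstep 0 (by norm_num) z hzS
    obtain ⟨a2, b2⟩ := hstep 1 (by norm_num) _ a1
    obtain ⟨a3, b3⟩ := hstep 2 (by norm_num) _ a2
    have hμ2 : 0 < μ ^ 2 := by positivity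
    calc _ ≤ _ := b3
      _ ≤ μ ^ 2 * (μ ^ 2 * (μ ^ 2 * (z ⬝ᵥ z))) := by gcongr; exact b2.trans (by gcongr)
      _ = _ := by ring
  -- the part of `B ^ 3 *ᵥ z` on `U`
  have hU : c ^ 2 * (z ⬝ᵥ z) ≤ ∑ u ∈ U, (B ^ 3 *ᵥ z) u ^ 2 := by
    -- All terms are nonnegative, so the square of the sum dominates the sum of squares.
    have h1 (u : ι) : ∑ i, ((B ^ 3) u i * z i) ^ 2 ≤ (B ^ 3 *ᵥ z) u ^ 2 := by
      have h0 (i : ι) : 0 ≤ (B ^ 3) u i * z i := mul_nonneg (hB3 u i) (hz0 i)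
      simp only [mulVec, dotProduct, sq]
      rw [Finset.sum_mul]
      exact Finset.sum_le_sum fun i hi =>
        mul_le_mul_of_nonneg_left (Finset.single_le_sum (fun j _ => h0 j) hi) (h0 i)
    refine le_trans ?_ (Finset.sum_le_sum fun u _ => h1 u)
    rw [Finset.sum_comm, dotProduct, Finset.mul_sum]
    refine Finset.sum_le_sum fun i _ => ?_
    by_cases hi : i ∈ W
    · obtain ⟨u, hu, hcu⟩ := hret i hi
      refine le_trans ?_ (Finset.single_le_sum (f := fun u => ((B ^ 3) u i * z i) ^ 2)
        (fun _ _ => sq_nonneg _) hu)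
      have : c ^ 2 ≤ (B ^ 3) u i ^ 2 := by gcongr
      calc c ^ 2 * (z i * z i) = c ^ 2 * z i ^ 2 := by ring
        _ ≤ (B ^ 3) u i ^ 2 * z i ^ 2 := by gcongr
        _ = _ := by ring
    · simp [hzW i hi]
  have hW : (T ^ 3 *ᵥ z) ⬝ᵥ (T ^ 3 *ᵥ z) ≤ ∑ i ∈ W, (B ^ 3 *ᵥ z) i ^ 2 := by
    have : (T ^ 3 *ᵥ z) ⬝ᵥ (T ^ 3 *ᵥ z) = ∑ i ∈ W, (T ^ 3 *ᵥ z) i ^ 2 := by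
      simp only [dotProduct, ← sq]
      exact (Finset.sum_subset (Finset.subset_univ W) fun i _ hi => by simp [hTW i hi]).symm
    rw [this]
    exact Finset.sum_le_sum fun i _ => pow_le_pow_left₀ (hT3 i) (hle i) 2
  have hsum : ∑ u ∈ U, (B ^ 3 *ᵥ z) u ^ 2 + ∑ i ∈ W, (B ^ 3 *ᵥ z) i ^ 2 ≤
      (B ^ 3 *ᵥ z) ⬝ᵥ (B ^ 3 *ᵥ z) := by
    rw [← Finset.sum_union hUW]
    simp only [dotProduct, ← sq]
    exact Finset.sum_le_sum_of_subset_of_nonneg (Finset.subset_univ _) fun _ _ _ => sq_nonneg _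
  linarith

/-- Iterates the three-step loss. After 3k steps the vector still lives in the ball of radius 3k
around `i`, so a form bound on balls suffices and no global bound is needed. -/
theorem truncate_pow_mulVec_single_le [DecidableEq ι] {B : Matrix ι ι ℝ} (hs : B.IsSymm)
    (hB : ∀ i j, 0 ≤ B i j) (hd : ∀ i, B i i ≠ 0) {μ c : ℝ} (hμ : 0 < μ) (hc : 0 ≤ c)
    (hcμ : c ^ 2 ≤ μ ^ 6) {U W : Finset ι}
    (hUW : Disjoint U W) (hret : ∀ i ∈ W, ∃ u ∈ U, c ≤ (B ^ 3) u i) (k : ℕ) {i : ι} (hi : i ∈ W)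
    (hi' : FormLEOn B μ ((nbhd B)^[3 * k] {i})) :
    (truncate B W ^ (3 * k) *ᵥ Pi.single i 1) ⬝ᵥ (truncate B W ^ (3 * k) *ᵥ Pi.single i 1) ≤
      (μ ^ 6 - c ^ 2) ^ k := by
  set T := truncate B W with hT
  have hT0 := truncate_nonneg hB W
  have hsupp (r : ℕ) : 0 ≤ T ^ r *ᵥ Pi.single i (1 : ℝ) ∧
      (∀ j ∉ (nbhd B)^[r] {i}, (T ^ r *ᵥ Pi.single i (1 : ℝ)) j = 0) ∧
      (∀ j ∉ W, (T ^ r *ᵥ Pi.single i (1 : ℝ)) j = 0) := by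
    induction r with
    | zero =>
      simp only [pow_zero, one_mulVec, Function.iterate_zero, id_eq, Finset.mem_singleton]
      refine ⟨Pi.single_nonneg.2 zero_le_one, fun j hj => Pi.single_eq_of_ne hj _,
        fun j hj => Pi.single_eq_of_ne (fun h => hj (by rw [h]; exact hi)) _⟩
    | succ r ih =>
      obtain ⟨h1, h2, h3⟩ := ih
      rw [pow_succ', ← mulVec_mulVec, Function.iterate_succ_apply']
      refine ⟨mulVec_nonneg_of_nonneg hT0 h1, fun j hj => ?_,
        fun j hj => truncate_mulVec_of_notMem B _ hj⟩
      by_cases hjW : j ∈ W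
      · rw [truncate_mulVec_of_mem B h3 hjW]
        exact mulVec_eq_zero_of_notMem_nbhd hs h2 j hj
      · exact truncate_mulVec_of_notMem B _ hjW
  induction k with
  | zero => rw [mul_zero, pow_zero, pow_zero, one_mulVec, single_dotProduct]; simp
  | succ k ih =>
    have hmono := iterate_nbhd_mono hd {i} (show 3 * k ≤ 3 * (k + 1) by omega)
    have ih' := ih (hi'.mono (by exact_mod_cast hmono))
    obtain ⟨h1, h2, h3⟩ := hsupp (3 * k)
    have := truncate_cube_mulVec_le hs hB hd hμ hc hUW hret (S := (nbhd B)^[3 * k] {i})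
      (by rwa [← Function.iterate_add_apply, show 3 + 3 * k = 3 * (k + 1) by ring]) h1 h2 h3
    rw [mulVec_mulVec, ← pow_add, show 3 + 3 * k = 3 * (k + 1) by ring] at this
    refine this.trans ?_
    rw [pow_succ' _ k]
    exact mul_le_mul_of_nonneg_left ih' (sub_nonneg.2 hcμ)

/-- On `V` the truncated matrix still acts as μ, so the trace bound for its power 3k compares the
multiplicity with the decayed column norms. -/
theorem finrank_mul_pow_le [DecidableEq ι] {B : Matrix ι ι ℝ} (hs : B.IsSymm)
    (hB : ∀ i j, 0 ≤ B i j) (hd : ∀ i, B i i ≠ 0) {μ c : ℝ} (hμ : 0 < μ) (hc : 0 ≤ c)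
    (hcμ : c ^ 2 ≤ μ ^ 6) {U W : Finset ι}
    (hUW : Disjoint U W) (hret : ∀ i ∈ W, ∃ u ∈ U, c ≤ (B ^ 3) u i) (k : ℕ) (hk : k ≠ 0)
    (hball : ∀ i, FormLEOn B μ ((nbhd B)^[3 * k] {i})) {V : Submodule ℝ (ι → ℝ)}
    (hV : ∀ x ∈ V, B *ᵥ x = μ • x ∧ ∀ i ∉ W, x i = 0) :
    Module.finrank ℝ V * (μ ^ 6) ^ k ≤ Fintype.card ι * (μ ^ 6 - c ^ 2) ^ k := by
  set T := truncate B W with hT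
  have hTV : ∀ x ∈ V, T *ᵥ x = μ • x := by
    intro x hx
    obtain ⟨h1, h2⟩ := hV x hx
    funext i
    by_cases hi : i ∈ W
    · rw [hT, truncate_mulVec_of_mem B h2 hi, h1]
    · rw [hT, truncate_mulVec_of_notMem B _ hi, Pi.smul_apply, h2 i hi, smul_zero]
  have hTr (r : ℕ) : ∀ x ∈ V, T ^ r *ᵥ x = μ ^ r • x := by
    intro x hx
    induction r with
    | zero => simp
    | succ r ih => rw [pow_succ, ← mulVec_mulVec, hTV x hx, mulVec_smul, ih, smul_smul, pow_succ']
  have h1 := finrank_mul_sq_le_sum_sq (S := T ^ (3 * k)) ((truncate_isSymm hs W).pow _) (hTr _)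
  have h2 : ((μ ^ (3 * k)) ^ 2 : ℝ) = (μ ^ 6) ^ k := by rw [← pow_mul, ← pow_mul]; ring_nf
  rw [h2] at h1
  refine h1.trans ?_
  rw [← nsmul_eq_mul, ← Finset.card_univ]
  refine Finset.sum_le_card_nsmul _ _ _ fun i _ => ?_
  by_cases hi : i ∈ W
  · exact truncate_pow_mulVec_single_le hs hB hd hμ hc hcμ hUW hret k hi (hball i)
  · have h3 : T *ᵥ Pi.single i (1 : ℝ) = 0 := by
      funext j
      simp [hT, truncate, hi]
    obtain ⟨r, hr⟩ : ∃ r, 3 * k = r + 1 := ⟨3 * k - 1, by omega⟩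
    rw [hr, pow_succ, ← mulVec_mulVec, h3]
    simp only [mulVec_zero, dotProduct_zero]
    exact pow_nonneg (by linarith) k

end Decay

/-! ### Multiplicity of the second eigenvalue -/

section SecondEigenvalue

variable {ι : Type*} [Fintype ι]

/-- The `c`-eigenvectors of `A` with coordinate sum zero. -/
noncomputable def zeroSumEigenspace (A : Matrix ι ι ℝ) (c : ℝ) : Submodule ℝ (ι → ℝ) :=
  Module.End.eigenspace A.mulVecLin c ⊓ LinearMap.ker (∑ i, LinearMap.proj i : (ι → ℝ) →ₗ[ℝ] ℝ)

theorem mem_zeroSumEigenspace {A : Matrix ι ι ℝ} {c : ℝ} {x : ι → ℝ} :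
    x ∈ zeroSumEigenspace A c ↔ A *ᵥ x = c • x ∧ ∑ i, x i = 0 := by
  simp [zeroSumEigenspace]

theorem quadForm_eq_of_eigenvector {A : Matrix ι ι ℝ} {c : ℝ} {x : ι → ℝ} (h : A *ᵥ x = c • x) :
    x ⬝ᵥ A *ᵥ x = c * (x ⬝ᵥ x) := by
  rw [h, dotProduct_smul, smul_eq_mul]

/-- An eigenvector vanishes on each closed set on which the form is bounded by the eigenvalue, if
the form exceeds this bound elsewhere. -/
theorem eigenvector_eq_zero_on_closed {A : Matrix ι ι ℝ} (hs : A.IsSymm)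
    (hA : ∀ i j, 0 ≤ A i j) {c : ℝ}
    (h0 : ∀ x : ι → ℝ, ∑ i, x i = 0 → x ⬝ᵥ A *ᵥ x ≤ c * (x ⬝ᵥ x)) {y : ι → ℝ}
    (hy : c * (y ⬝ᵥ y) < y ⬝ᵥ A *ᵥ y) {S : Finset ι} (hcl : ∀ i ∈ S, ∀ j ∉ S, A i j = 0)
    (hS : FormLEOn A c S) {w : ι → ℝ} (hw : A *ᵥ w = c • w) : ∀ i ∈ S, w i = 0 := by
  classical
  have hcl' : ∀ i ∉ S, ∀ j ∈ S, A i j = 0 := fun i hi j hj => by rw [hs.apply]; exact hcl j hj i hi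
  set p : (ι → ℝ) → ι → ℝ := fun x i => if i ∈ S then x i else 0 with hp
  set q : (ι → ℝ) → ι → ℝ := fun x i => if i ∈ S then 0 else x i with hq
  have hAp (x : ι → ℝ) (i : ι) (hi : i ∈ S) : (A *ᵥ p x) i = (A *ᵥ x) i :=
    Finset.sum_congr rfl fun j _ => by
      by_cases hj : j ∈ S
      · simp [hp, hj]
      · simp [hcl i hi j hj]
  have hpA (x : ι → ℝ) : p x ⬝ᵥ A *ᵥ q x = 0 := Finset.sum_eq_zero fun i _ => by
    by_cases hi : i ∈ S
    · refine mul_eq_zero_of_right _ (Finset.sum_eq_zero fun j _ => ?_)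
      by_cases hj : j ∈ S
      · simp [hq, hj]
      · simp [hcl i hi j hj]
    · simp [hp, hi]
  have hpq (x : ι → ℝ) : p x ⬝ᵥ q x = 0 := Finset.sum_eq_zero fun i _ => by
    by_cases hi : i ∈ S <;> simp [hp, hq, hi]
  have hsum (x : ι → ℝ) : (1 : ℝ) • p x + (1 : ℝ) • q x = x := by
    funext i
    by_cases hi : i ∈ S <;> simp [hp, hq, hi]
  -- The form splits along `S`, so the excess at `y` comes from outside `S`.
  have hq' : c * (q y ⬝ᵥ q y) < q y ⬝ᵥ A *ᵥ q y := by
    have h1 := hS (p y) (fun i hi => by simp [hp] at hi ⊢; simp [hi])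
    have h2 := hy
    rw [← hsum y, quadForm_add_smul hs, dotProduct_add_smul_self, hpA, hpq] at h2
    linarith
  have hz : p w = 0 := by
    refine eq_zero_of_far hs hA h0 hq' (le_of_eq ?_) (fun i => ?_) (fun i j => ?_)
    · simp only [dotProduct, Finset.mul_sum]
      refine Finset.sum_congr rfl fun i _ => ?_
      by_cases hi : i ∈ S
      · rw [hAp w i hi, hw]
        simp [hp, hi]
        ring
      · simp [hp, hi]
    · by_cases hi : i ∈ S <;> simp [hp, hq, hi]
    · by_cases hi : i ∈ S
      · left; simp [hq, hi]
      · by_cases hj : j ∈ S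
        · right; left; exact hcl' i hi j hj
        · right; right; simp [hp, hj]
  intro i hi
  simpa [hp, hi] using congrFun hz i

/-- A sparse set of indices of degree at least two which is close to every index of a component
with at least three elements. -/
theorem exists_sparse_net (B : Matrix ι ι ℝ) (hs : B.IsSymm) (hd : ∀ i, B i i ≠ 0) :
    ∃ U : Finset ι, 3 * U.card ≤ Fintype.card ι ∧ ∀ i,
      (∃ u ∈ U, ∃ k j, B u k ≠ 0 ∧ B k j ≠ 0 ∧ B j i ≠ 0) ∨
      ∀ j ∈ nbhd B {i}, ∀ k ∉ nbhd B {i}, B j k = 0 := by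
  classical
  -- A maximal family of centres with disjoint closed neighbourhoods of size at least 3;
  -- disjointness gives the bound on `U`.
  obtain ⟨U, hU, hmax⟩ := Finset.exists_max_image
    (Finset.univ.filter fun U : Finset ι => (∀ u ∈ U, 3 ≤ (nbhd B {u}).card) ∧
      (U : Set ι).PairwiseDisjoint fun u => nbhd B {u}) Finset.card ⟨∅, by simp⟩
  simp only [Finset.mem_filter, Finset.mem_univ, true_and] at hU hmax
  obtain ⟨hU3, hUd⟩ := hU
  refine ⟨U, ?_, fun i => ?_⟩
  · have h1 := Finset.card_biUnion hUd
    have h2 : U.card * 3 ≤ ∑ u ∈ U, (nbhd B {u}).card := by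
      simpa using Finset.card_nsmul_le_sum U _ 3 hU3
    have h3 := Finset.card_le_univ (U.biUnion fun u => nbhd B {u})
    omega
  · have hself (j : ι) : j ∈ nbhd B {j} := subset_nbhd hd _ (by simp)
    have hmem (j k : ι) : k ∈ nbhd B {j} ↔ B j k ≠ 0 := by simp [mem_nbhd]
    have hnear (j : ι) (hj : 3 ≤ (nbhd B {j}).card) : ∃ u ∈ U, ∃ k, B u k ≠ 0 ∧ B k j ≠ 0 := by
      by_cases hjU : j ∈ U
      · exact ⟨j, hjU, j, hd j, hd j⟩
      · by_contra! hcon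
        have := hmax (insert j U) ⟨fun u hu => ?_, ?_⟩
        · rw [Finset.card_insert_of_notMem hjU] at this
          omega
        · rcases Finset.mem_insert.1 hu with rfl | hu
          exacts [hj, hU3 u hu]
        · rw [Finset.coe_insert]
          refine hUd.insert fun u hu _ => ?_
          rw [Finset.disjoint_left]
          intro k hk hk'
          rw [hmem] at hk hk'
          exact hk (by rw [hs.apply]; exact hcon u hu k hk')
    by_cases h : ∃ j ∈ nbhd B {i}, 3 ≤ (nbhd B {j}).card
    · obtain ⟨j, hj, hj3⟩ := h
      obtain ⟨u, hu, k, huk, hkj⟩ := hnear j hj3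
      exact Or.inl ⟨u, hu, k, j, huk, hkj, by rw [← hs.apply]; exact (hmem _ _).1 hj⟩
    -- Every closed neighbourhood around a neighbour of `i` has at most two elements, so an edge
    -- leaving the neighbourhood of `i` would produce a third.
    · push Not at h
      refine Or.inr fun j hj k hk => ?_
      by_contra hjk
      have hji : j ≠ i := by
        rintro rfl
        exact hk ((hmem _ _).2 hjk)
      have hkj : k ≠ j := by
        rintro rfl
        exact hk hj
      have hki : k ≠ i := by
        rintro rfl
        exact hk (hself _)
      have : ({i, j, k} : Finset ι) ⊆ nbhd B {j} := by
        intro a ha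
        simp only [Finset.mem_insert, Finset.mem_singleton] at ha
        rcases ha with rfl | rfl | rfl
        · rw [hmem, ← hs.apply]; exact (hmem _ _).1 hj
        · exact hself _
        · exact (hmem _ _).2 hjk
      have h3 : ({i, j, k} : Finset ι).card = 3 :=
        Finset.card_eq_three.2 ⟨i, j, k, hji.symm, hki.symm, hkj.symm, rfl⟩
      have := Finset.card_le_card this
      have := h j hj
      omega

theorem FormLEOn.one_add [DecidableEq ι] {A : Matrix ι ι ℝ} {c : ℝ} {S : Set ι}
    (h : FormLEOn A c S) : FormLEOn (1 + A) (1 + c) S := by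
  intro x hx
  rw [add_mulVec, one_mulVec, dotProduct_add]
  linarith [h x hx]

/-- A nonnegative symmetric matrix of bounded degree whose form is at most `c` on zero-sum vectors,
but not everywhere, has few independent zero-sum `c`-eigenvectors. -/
theorem exists_finrank_zeroSumEigenspace_le {c b : ℝ} (hc : 0 < c) (hb : 0 < b) (Δ : ℕ) :
    ∃ C : ℕ, ∀ (ι : Type) [Fintype ι] (A : Matrix ι ι ℝ), A.IsSymm → (∀ i, A i i = 0) →
      (∀ i j, A i j = 0 ∨ b ≤ A i j) → (∀ i, (nbhd A {i}).card ≤ Δ) →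
      (∀ x : ι → ℝ, ∑ i, x i = 0 → x ⬝ᵥ A *ᵥ x ≤ c * (x ⬝ᵥ x)) →
      ¬ FormLEOn A c Set.univ →
      Module.finrank ℝ (zeroSumEigenspace A c) ≤ C ∨
        5 * Module.finrank ℝ (zeroSumEigenspace A c) ≤ 2 * Fintype.card ι := by
  set μ := 1 + c with hμ
  have hμ0 : 0 < μ := by positivity
  have hμ1 : 1 ≤ μ := by linarith
  -- A lower bound for all nonzero entries of 1 + A, diagonal included; a walk of three steps then
  -- has weight at least β³.
  set β := min 1 b with hβ
  have hβ0 : 0 < β := lt_min one_pos hb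
  have hβ1 : β ≤ 1 := min_le_left _ _
  have hγ : (β ^ 3) ^ 2 ≤ μ ^ 6 := by
    rw [← pow_mul]
    exact pow_le_pow_left₀ hβ0.le (hβ1.trans hμ1) 6
  have hρ : (μ ^ 6 - (β ^ 3) ^ 2) / μ ^ 6 < 1 := by
    rw [div_lt_one (by positivity)]
    have : 0 < (β ^ 3) ^ 2 := by positivity
    linarith
  -- The net costs n/3, and n/3 + n/15 = 2n/5.
  obtain ⟨k', hk'⟩ := exists_pow_lt_of_lt_one (show (0 : ℝ) < 1 / 15 by norm_num) hρ
  have hρ0 : 0 ≤ (μ ^ 6 - (β ^ 3) ^ 2) / μ ^ 6 := div_nonneg (by linarith) (by positivity)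
  obtain ⟨k, hk, hk0⟩ : ∃ k : ℕ, ((μ ^ 6 - (β ^ 3) ^ 2) / μ ^ 6) ^ k < 1 / 15 ∧ k ≠ 0 :=
    ⟨k' + 1, (pow_le_pow_of_le_one hρ0 hρ.le (Nat.le_succ k')).trans_lt hk', by omega⟩
  refine ⟨(Δ + 1) ^ (3 * k + 1), ?_⟩
  intro ι _ A hs hd hAb hdeg h0 hbad
  classical
  have hA : ∀ i j, 0 ≤ A i j := fun i j => (hAb i j).elim (fun h => h.ge) hb.le.trans
  -- The unit diagonal makes the iterated neighbourhoods increasing and shifts the eigenvalue to μ.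
  set B := 1 + A with hB
  have hBs : B.IsSymm := isSymm_one.add hs
  have hBd : ∀ i, B i i = 1 := fun i => by simp [hB, hd]
  have hBd' : ∀ i, B i i ≠ 0 := fun i => by simp [hBd]
  have hBo : ∀ i j, i ≠ j → B i j = A i j := fun i j h => by simp [hB, h]
  have hBβ : ∀ i j, B i j ≠ 0 → β ≤ B i j := by
    intro i j h
    by_cases hij : i = j
    · rw [hij, hBd]; exact hβ1
    · rw [hBo i j hij] at h ⊢
      exact (min_le_right _ _).trans ((hAb i j).resolve_left h)
  have hB0 : ∀ i j, 0 ≤ B i j := by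
    intro i j
    by_cases h : B i j = 0
    exacts [h.ge, hβ0.le.trans (hBβ i j h)]
  have hAB : ∀ i j, B i j = 0 → A i j = 0 := by
    intro i j h
    by_cases hij : i = j
    · rw [hij]; exact hd j
    · rwa [← hBo i j hij]
  have hBdeg : ∀ i, (nbhd B {i}).card ≤ Δ + 1 := by
    intro i
    have : nbhd B {i} ⊆ insert i (nbhd A {i}) := by
      intro j hj
      simp only [mem_nbhd, Finset.mem_singleton, exists_eq_left, Finset.mem_insert] at hj ⊢
      by_cases hij : i = j
      · exact Or.inl hij.symm
      · right; rwa [← hBo i j hij]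
    exact (Finset.card_le_card this).trans ((Finset.card_insert_le _ _).trans (by gcongr; exact hdeg i))
  by_cases hball : ∀ i, FormLEOn A c ((nbhd B)^[3 * k] {i})
  · right
    obtain ⟨y, hy⟩ : ∃ y : ι → ℝ, c * (y ⬝ᵥ y) < y ⬝ᵥ A *ᵥ y := by
      by_contra! hcon
      exact hbad fun x _ => hcon x
    obtain ⟨U, hU, hnet⟩ := exists_sparse_net B hBs hBd'
    set K := zeroSumEigenspace A c
    have h1 := finrank_le_card_add_finrank_inf K U
    set V := K ⊓ LinearMap.ker (LinearMap.funLeft ℝ ℝ (fun i : U => (i : ι)))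
    set W : Finset ι := Finset.univ.filter fun i => i ∉ U ∧
      ∃ u ∈ U, ∃ k j, B u k ≠ 0 ∧ B k j ≠ 0 ∧ B j i ≠ 0 with hW
    have h2 := finrank_mul_pow_le (B := B) (μ := μ) (c := β ^ 3) (U := U) (W := W) (V := V) hBs hB0
      hBd' hμ0 (by positivity) hγ ?_ ?_ k hk0 (fun i => (hball i).one_add) ?_
    · have h3 : (Module.finrank ℝ V : ℝ) ≤
          Fintype.card ι * ((μ ^ 6 - (β ^ 3) ^ 2) / μ ^ 6) ^ k := by
        rw [div_pow, mul_div_assoc', le_div_iff₀ (by positivity)]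
        exact h2
      have h4 : (Module.finrank ℝ V : ℝ) ≤ Fintype.card ι * (1 / 15) :=
        h3.trans (by gcongr)
      have h5 : 15 * Module.finrank ℝ V ≤ Fintype.card ι := by
        have : (15 * Module.finrank ℝ V : ℝ) ≤ Fintype.card ι := by linarith
        exact_mod_cast this
      omega
    · rw [Finset.disjoint_left]
      intro u hu hu'
      exact (Finset.mem_filter.1 hu').2.1 hu
    · intro i hi
      obtain ⟨-, -, u, hu, k, j, huk, hkj, hji⟩ := Finset.mem_filter.1 hi
      refine ⟨u, hu, ?_⟩
      have e1 : β * β ≤ (B * B) u j := by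
        rw [Matrix.mul_apply]
        refine le_trans ?_ (Finset.single_le_sum (f := fun l => B u l * B l j)
          (fun l _ => mul_nonneg (hB0 _ _) (hB0 _ _)) (Finset.mem_univ k))
        exact mul_le_mul (hBβ _ _ huk) (hBβ _ _ hkj) hβ0.le (hB0 _ _)
      have e0 : ∀ l, 0 ≤ (B * B) u l := fun l =>
        Finset.sum_nonneg fun m _ => mul_nonneg (hB0 _ _) (hB0 _ _)
      rw [pow_succ, pow_succ B, sq, sq, Matrix.mul_apply]
      refine le_trans ?_ (Finset.single_le_sum (f := fun l => (B * B) u l * B l i)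
        (fun l _ => mul_nonneg (e0 _) (hB0 _ _)) (Finset.mem_univ j))
      exact mul_le_mul e1 (hBβ _ _ hji) hβ0.le (e0 _)
    · rintro x ⟨hxK, hxU⟩
      have hx := (mem_zeroSumEigenspace.1 hxK).1
      refine ⟨by rw [hB, add_mulVec, one_mulVec, hx, hμ, add_smul, one_smul], fun i hi => ?_⟩
      by_cases hiU : i ∈ U
      · exact congrFun hxU ⟨i, hiU⟩
      · rcases hnet i with h | h
        · exact absurd (Finset.mem_filter.2 ⟨Finset.mem_univ i, hiU, h⟩) hi
        · refine eigenvector_eq_zero_on_closed hs hA h0 hy (S := nbhd B {i})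
            (fun j hj l hl => hAB _ _ (h j hj l hl)) ((hball i).mono ?_) hx i
            (subset_nbhd hBd' _ (by simp))
          exact_mod_cast iterate_nbhd_mono hBd' {i} (show 1 ≤ 3 * k by omega)
  · left
    push Not at hball
    obtain ⟨i, hi⟩ := hball
    simp only [FormLEOn] at hi
    push Not at hi
    obtain ⟨x, hxS, hx⟩ := hi
    -- One extra step of radius ensures that the support of `z` is not adjacent to that of `x`.
    refine le_trans (finrank_le_card_of_vanishing ((nbhd B)^[3 * k + 1] {i}) fun z hz hz0 => ?_)
      (card_iterate_nbhd_le hBdeg i _)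
    have hz' := (mem_zeroSumEigenspace.1 hz).1
    rw [Function.iterate_succ_apply'] at hz0
    refine eq_zero_of_far hs hA h0 hx (quadForm_eq_of_eigenvector hz').ge (fun j => ?_)
      (fun j l => ?_)
    · by_cases hj : j ∈ (nbhd B)^[3 * k] {i}
      · exact Or.inr (hz0 j (subset_nbhd hBd' _ hj))
      · exact Or.inl (hxS j (by simpa using hj))
    · by_cases hj : j ∈ (nbhd B)^[3 * k] {i}
      · by_cases hjl : B j l = 0
        · exact Or.inr (Or.inl (hAB _ _ hjl))
        · exact Or.inr (Or.inr (hz0 l (mem_nbhd.2 ⟨j, hj, hjl⟩)))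
      · exact Or.inl (hxS j (by simpa using hj))

end SecondEigenvalue

/-! ### Codes of bounded negative degree -/

section OneCluster

/-- A code with inner products `α` or at most `-α`, with boundedly many negative inner products at
each vector, has at most `2(d-1)` elements once the dimension `d` is large. -/
theorem exists_card_le_of_bounded_degree {α : ℝ} (hα0 : 0 < α) (hα1 : α < 1) (Δ : ℕ) :
    ∃ C : ℕ, ∀ (d : ℕ) (ι : Type) [Fintype ι] (v : ι → EuclideanSpace ℝ (Fin d)), C ≤ d →
      (∀ i, ‖v i‖ = 1) → (∀ i j, i ≠ j → inner ℝ (v i) (v j) = α ∨ inner ℝ (v i) (v j) ≤ -α) →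
      (∀ i, ∀ N : Finset ι, (∀ j ∈ N, inner ℝ (v i) (v j) ≤ -α) → N.card ≤ Δ) →
      Fintype.card ι ≤ 2 * (d - 1) := by
  obtain ⟨C, hC⟩ := exists_finrank_zeroSumEigenspace_le (c := 1 - α) (b := 2 * α) (by linarith)
    (by positivity) Δ
  -- From n ≤ d + 1 + 2n/5 follows n ≤ 5(d+1)/3, which is at most 2(d-1) once d ≥ 11.
  refine ⟨C + 11, ?_⟩
  intro d ι _ v hd hv1 hv hdeg
  classical
  set A : Matrix ι ι ℝ := Matrix.of fun i j => if i = j then 0 else α - inner ℝ (v i) (v j) with hA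
  have hs : A.IsSymm := by
    ext i j
    by_cases h : i = j
    · simp [h]
    · simp [hA, h, Ne.symm h, real_inner_comm]
  have hdiag : ∀ i, A i i = 0 := fun i => by simp [hA]
  have hAb : ∀ i j, A i j = 0 ∨ 2 * α ≤ A i j := by
    intro i j
    by_cases h : i = j
    · left; rw [h, hdiag]
    · simp only [hA, of_apply, if_neg h]
      rcases hv i j h with h' | h'
      · left; rw [h', sub_self]
      · right; linarith
  have hA0 : ∀ i j, 0 ≤ A i j := fun i j =>
    (hAb i j).elim (fun h => h.ge) (by positivity : (0 : ℝ) ≤ 2 * α).trans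
  have hAdeg : ∀ i, (nbhd A {i}).card ≤ Δ := by
    intro i
    refine hdeg i _ fun j hj => ?_
    simp only [mem_nbhd, Finset.mem_singleton, exists_eq_left] at hj
    have hij : i ≠ j := by
      rintro rfl
      exact hj (hdiag i)
    refine (hv i j hij).resolve_left fun h => hj ?_
    simp [hA, hij, h]
  have hgram : ∀ i j, inner ℝ (v i) (v j) = (1 - α) * (if i = j then 1 else 0) + α - A i j := by
    intro i j
    by_cases h : i = j
    · subst h
      rw [real_inner_self_eq_norm_sq, hv1, hdiag]; simp
    · simp [hA, h]
  set Φ := Fintype.linearCombination ℝ v with hΦ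
  have hinner (i : ι) (x : ι → ℝ) :
      inner ℝ (v i) (Φ x) = (1 - α) * x i + α * ∑ j, x j - (A *ᵥ x) i := by
    rw [hΦ, Fintype.linearCombination_apply, inner_sum]
    simp only [inner_smul_right, hgram, mul_sub, mul_add, Finset.sum_sub_distrib,
      Finset.sum_add_distrib, mulVec, dotProduct]
    congr 1
    · congr 1
      · simp [mul_comm]
      · rw [← Finset.sum_mul, mul_comm]
    · exact Finset.sum_congr rfl fun j _ => mul_comm _ _
  have hnorm (x : ι → ℝ) :
      ‖Φ x‖ ^ 2 = (1 - α) * (x ⬝ᵥ x) + α * (∑ j, x j) ^ 2 - x ⬝ᵥ A *ᵥ x := by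
    rw [← real_inner_self_eq_norm_sq]
    conv_lhs => enter [2]; rw [hΦ, Fintype.linearCombination_apply]
    rw [sum_inner]
    simp only [inner_smul_left, hinner, conj_trivial, mul_sub, mul_add, Finset.sum_sub_distrib,
      Finset.sum_add_distrib]
    rw [← Finset.sum_mul, sq, dotProduct, dotProduct]
    congr 2
    · rw [Finset.mul_sum]
      exact Finset.sum_congr rfl fun j _ => by ring
    · ring
  have hform : ∀ x : ι → ℝ, ∑ i, x i = 0 → x ⬝ᵥ A *ᵥ x ≤ (1 - α) * (x ⬝ᵥ x) := by
    intro x hx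
    have := hnorm x
    rw [hx] at this
    nlinarith [sq_nonneg ‖Φ x‖]
  have hrank : Fintype.card ι ≤ d + Module.finrank ℝ (LinearMap.ker Φ) := by
    have h1 := LinearMap.finrank_range_add_finrank_ker Φ
    have h2 := Submodule.finrank_le (LinearMap.range Φ)
    simp only [Module.finrank_fintype_fun_eq_card, finrank_euclideanSpace, Fintype.card_fin]
      at h1 h2
    omega
  have hkerEig : ∀ x ∈ LinearMap.ker Φ, ∑ i, x i = 0 → x ∈ zeroSumEigenspace A (1 - α) := by
    intro x hx hx0
    refine mem_zeroSumEigenspace.2 ⟨funext fun i => ?_, hx0⟩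
    have := hinner i x
    rw [LinearMap.mem_ker.1 hx, inner_zero_right, hx0] at this
    simp only [Pi.smul_apply, smul_eq_mul]
    linarith
  by_cases hpsd : FormLEOn A (1 - α) Set.univ
  · have hker : LinearMap.ker Φ ≤ zeroSumEigenspace A (1 - α) := by
      intro x hx
      refine hkerEig x hx ?_
      have h1 := hnorm x
      rw [LinearMap.mem_ker.1 hx, norm_zero] at h1
      have h2 := hpsd x (by simp)
      have h3 : (∑ j, x j) ^ 2 ≤ 0 := by
        by_contra! h
        nlinarith
      exact pow_eq_zero_iff two_ne_zero |>.1 (le_antisymm h3 (sq_nonneg _))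
    have h4 := two_mul_finrank_eigenspace_le hs hA0 hdiag (by linarith) hpsd
    by_cases hbot : LinearMap.ker Φ = ⊥
    · rw [hbot, finrank_bot] at hrank
      omega
    · obtain ⟨x, hx, hx0⟩ := Submodule.exists_mem_ne_zero_of_ne_bot hbot
      -- The absolute value of a nonzero kernel vector is an eigenvector but not zero-sum, so the
      -- inclusion is strict. This lost dimension turns 2d into 2(d-1).
      have hlt : LinearMap.ker Φ < Module.End.eigenspace A.mulVecLin (1 - α) := by
        refine lt_of_le_of_ne (hker.trans inf_le_left) fun heq => hx0 ?_
        have hx' := (mem_zeroSumEigenspace.1 (hker hx)).1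
        have habs : |x| ∈ LinearMap.ker Φ := by
          rw [heq, Module.End.mem_eigenspace_iff]
          exact hpsd.mulVec_abs_eq hs hA0 hx'
        have h5 := (mem_zeroSumEigenspace.1 (hker habs)).2
        have h6 := (Finset.sum_eq_zero_iff_of_nonneg (fun i _ => by simp)).1 h5
        funext i
        simpa using h6 i (Finset.mem_univ i)
      have := Submodule.finrank_lt_finrank_of_lt hlt
      omega
  · have h1 := hC ι A hs hdiag hAb hAdeg hform hpsd
    have h2 : Module.finrank ℝ (LinearMap.ker Φ) ≤
        Module.finrank ℝ (zeroSumEigenspace A (1 - α)) + 1 := by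
      set σ := (∑ i, LinearMap.proj i : (ι → ℝ) →ₗ[ℝ] ℝ)
      have h3 := Submodule.finrank_sup_add_finrank_inf_eq (LinearMap.ker Φ) (LinearMap.ker σ)
      have h4 := LinearMap.finrank_range_add_finrank_ker σ
      have h5 := Submodule.finrank_le (LinearMap.range σ)
      have h6 := Submodule.finrank_le (LinearMap.ker Φ ⊔ LinearMap.ker σ)
      have h7 : LinearMap.ker Φ ⊓ LinearMap.ker σ ≤ zeroSumEigenspace A (1 - α) := by
        rintro x ⟨hx, hx'⟩
        exact hkerEig x hx (by simpa [σ] using hx')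
      have h8 := Submodule.finrank_mono h7
      rw [Module.finrank_self] at h5
      omega
    omega

end OneCluster

/-! ### Ramsey's theorem for finite sets -/

section Ramsey

theorem exists_clique_or_independent (p q : ℕ) : ∃ R : ℕ, ∀ {X : Type} (r : X → X → Prop),
    (∀ a b, r a b → r b a) → ∀ S : Finset X, R ≤ S.card →
      (∃ C ⊆ S, C.card = p ∧ ∀ a ∈ C, ∀ b ∈ C, a ≠ b → r a b) ∨
      (∃ I ⊆ S, I.card = q ∧ ∀ a ∈ I, ∀ b ∈ I, a ≠ b → ¬ r a b) := by
  induction p generalizing q with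
  | zero => exact ⟨0, fun r _ S _ => Or.inl ⟨∅, by simp⟩⟩
  | succ p ihp =>
    induction q with
    | zero => exact ⟨0, fun r _ S _ => Or.inr ⟨∅, by simp⟩⟩
    | succ q ihq =>
      obtain ⟨R₁, h₁⟩ := ihp (q + 1)
      obtain ⟨R₂, h₂⟩ := ihq
      -- Pigeonhole on the neighbours and non-neighbours of one element.
      refine ⟨R₁ + R₂ + 1, fun {X} r hr S hS => ?_⟩
      classical
      obtain ⟨a, ha⟩ : S.Nonempty := Finset.card_pos.1 (by omega)
      have hcard := Finset.card_filter_add_card_filter_not (s := S.erase a) (fun b => r a b)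
      rw [Finset.card_erase_of_mem ha] at hcard
      rcases Nat.lt_or_ge ((S.erase a).filter fun b => r a b).card R₁ with hlt | hge
      · rcases h₂ r hr ((S.erase a).filter fun b => ¬ r a b) (by omega) with
          ⟨C, hCS, hC⟩ | ⟨I, hIS, hIc, hI⟩
        · exact Or.inl ⟨C, hCS.trans ((Finset.filter_subset _ _).trans (Finset.erase_subset _ _)),
            hC⟩
        · have hmem : ∀ b ∈ I, b ≠ a ∧ b ∈ S ∧ ¬ r a b := fun b hb => by
            have := hIS hb
            simp only [Finset.mem_filter, Finset.mem_erase] at this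
            exact ⟨this.1.1, this.1.2, this.2⟩
          refine Or.inr ⟨insert a I, ?_, ?_, ?_⟩
          · exact Finset.insert_subset ha fun b hb => (hmem b hb).2.1
          · rw [Finset.card_insert_of_notMem fun h => (hmem a h).1 rfl, hIc]
          · intro b hb c hc hbc
            rcases Finset.mem_insert.1 hb with hb' | hb' <;>
              rcases Finset.mem_insert.1 hc with hc' | hc'
            · exact absurd (hb'.trans hc'.symm) hbc
            · rw [hb']; exact (hmem c hc').2.2
            · rw [hc']; exact fun h => (hmem b hb').2.2 (hr _ _ h)
            · exact hI b hb' c hc' hbc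
      · rcases h₁ r hr _ hge with ⟨C, hCS, hCc, hC⟩ | ⟨I, hIS, hI⟩
        · have hmem : ∀ b ∈ C, b ≠ a ∧ b ∈ S ∧ r a b := fun b hb => by
            have := hCS hb
            simp only [Finset.mem_filter, Finset.mem_erase] at this
            exact ⟨this.1.1, this.1.2, this.2⟩
          refine Or.inl ⟨insert a C, ?_, ?_, ?_⟩
          · exact Finset.insert_subset ha fun b hb => (hmem b hb).2.1
          · rw [Finset.card_insert_of_notMem fun h => (hmem a h).1 rfl, hCc]
          · intro b hb c hc hbc
            rcases Finset.mem_insert.1 hb with hb' | hb' <;>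
              rcases Finset.mem_insert.1 hc with hc' | hc'
            · exact absurd (hb'.trans hc'.symm) hbc
            · rw [hb']; exact (hmem c hc').2.2
            · rw [hc']; exact hr _ _ (hmem b hb').2.2
            · exact hC b hb' c hc' hbc
        · exact Or.inr ⟨I, hIS.trans ((Finset.filter_subset _ _).trans (Finset.erase_subset _ _)),
            hI⟩

end Ramsey

/-! ### Geometry of the clusters -/

theorem sub_le_sum_of_few_exceptions {E : Type} {I : Finset E} {f : E → ℝ} {α : ℝ} {K : ℕ}
    (hα1 : α ≤ 1) (hf : ∀ x ∈ I, -1 ≤ f x) {N : Finset E} (hN : N ⊆ I) (hNK : N.card ≤ K)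
    (hf' : ∀ x ∈ I, x ∉ N → α ≤ f x) : α * I.card - 2 * K ≤ ∑ x ∈ I, f x := by
  classical
  -- An exceptional term falls short of `α` by at most 1 + α ≤ 2.
  have h1 : ∑ x ∈ I, (α - if x ∈ N then 2 else 0) ≤ ∑ x ∈ I, f x := by
    refine Finset.sum_le_sum fun x hx => ?_
    split_ifs with h
    · linarith [hf x hx]
    · linarith [hf' x hx h]
  rw [Finset.sum_sub_distrib, Finset.sum_const, ← Finset.sum_filter, Finset.filter_mem_eq_inter,
    Finset.inter_eq_right.2 hN, Finset.sum_const, nsmul_eq_mul, nsmul_eq_mul] at h1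
  have h2 : (N.card : ℝ) ≤ K := by exact_mod_cast hNK
  linarith

section Clusters

variable {E : Type} [NormedAddCommGroup E] [InnerProductSpace ℝ E]

theorem norm_sum_sq_eq {I : Finset E} {α : ℝ} (h1 : ∀ x ∈ I, ‖x‖ = 1)
    (hI : ∀ x ∈ I, ∀ y ∈ I, x ≠ y → inner ℝ x y = α) :
    ‖∑ x ∈ I, x‖ ^ 2 = I.card * (1 - α) + α * (I.card : ℝ) ^ 2 := by
  classical
  rw [← real_inner_self_eq_norm_sq, sum_inner]
  have : ∀ x ∈ I, inner ℝ x (∑ y ∈ I, y) = (1 - α) + α * I.card := by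
    intro x hx
    rw [inner_sum, ← Finset.add_sum_erase _ _ hx, real_inner_self_eq_norm_sq, h1 x hx,
      Finset.sum_congr rfl fun y hy => hI x hx y (Finset.mem_of_mem_erase hy)
        (Finset.ne_of_mem_erase hy).symm, Finset.sum_const, Finset.card_erase_of_mem hx, nsmul_eq_mul,
      Nat.cast_sub (Finset.card_pos.2 ⟨x, hx⟩)]
    push_cast
    ring
  rw [Finset.sum_congr rfl this, Finset.sum_const, nsmul_eq_mul]
  ring

/-- The square norm of the sum of the vectors is nonnegative. -/
theorem mul_card_le_of_negative {C : Finset E} {α : ℝ} (hα : 0 ≤ α) (h1 : ∀ x ∈ C, ‖x‖ = 1)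
    (hC : ∀ x ∈ C, ∀ y ∈ C, x ≠ y → inner ℝ x y ≤ -α) : α * C.card ≤ 1 + α := by
  classical
  have h2 : ∀ x ∈ C, inner ℝ x (∑ y ∈ C, y) ≤ 1 + α - α * C.card := by
    intro x hx
    rw [inner_sum, ← Finset.add_sum_erase _ _ hx, real_inner_self_eq_norm_sq, h1 x hx]
    have := Finset.sum_le_card_nsmul (C.erase x) (fun y => inner ℝ x y) (-α) fun y hy =>
      hC x hx y (Finset.mem_of_mem_erase hy) (Finset.ne_of_mem_erase hy).symm
    rw [Finset.card_erase_of_mem hx, nsmul_eq_mul,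
      Nat.cast_sub (Finset.card_pos.2 ⟨x, hx⟩)] at this
    push_cast at this
    linarith
  have h3 := Finset.sum_le_card_nsmul C _ _ h2
  rw [← sum_inner, real_inner_self_eq_norm_sq, nsmul_eq_mul] at h3
  rcases C.eq_empty_or_nonempty with rfl | hne
  · simp only [Finset.card_empty, Nat.cast_zero, mul_zero]
    linarith
  · have hpos : (0 : ℝ) < C.card := by exact_mod_cast Finset.card_pos.2 hne
    have := nonneg_of_mul_nonneg_right ((sq_nonneg _).trans h3) hpos
    linarith

/-- The α-contributions cancel in the difference of the sums over `T` and `S`, whose square norm is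
therefore only 2K(1-α), while its inner product with `v` is at least 2αK. This contradicts
Cauchy–Schwarz. -/
theorem not_both_large {I S T : Finset E} {v : E} {α : ℝ} {K : ℕ} (hα : 0 < α)
    (h1 : ∀ x ∈ I, ‖x‖ = 1) (hI : ∀ x ∈ I, ∀ y ∈ I, x ≠ y → inner ℝ x y = α) (hv : ‖v‖ = 1)
    (hK : 1 < 2 * α ^ 2 * K) (hS : S ⊆ I) (hT : T ⊆ I) (hSK : S.card = K) (hTK : T.card = K)
    (hvS : ∀ x ∈ S, inner ℝ v x ≤ -α) (hvT : ∀ x ∈ T, inner ℝ v x = α) : False := by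
  have hST : ∀ x ∈ S, ∀ y ∈ T, inner ℝ x y = α := by
    intro x hx y hy
    refine hI x (hS hx) y (hT hy) ?_
    rintro rfl
    linarith [hvS x hx, hvT x hy]
  have e1 := norm_sum_sq_eq (fun x hx => h1 x (hS hx)) fun x hx y hy => hI x (hS hx) y (hS hy)
  have e2 := norm_sum_sq_eq (fun x hx => h1 x (hT hx)) fun x hx y hy => hI x (hT hx) y (hT hy)
  have e3 : inner ℝ (∑ y ∈ T, y) (∑ x ∈ S, x) = α * (K : ℝ) ^ 2 := by
    rw [real_inner_comm, sum_inner, Finset.sum_congr rfl fun x hx => by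
      rw [inner_sum, Finset.sum_congr rfl (hST x hx), Finset.sum_const],
      Finset.sum_const, hSK, hTK, nsmul_eq_mul, nsmul_eq_mul]
    ring
  have e4 : ‖(∑ y ∈ T, y) - ∑ x ∈ S, x‖ ^ 2 = 2 * K * (1 - α) := by
    rw [norm_sub_sq_real, e1, e2, e3, hSK, hTK]
    ring
  have e5 : 2 * α * K ≤ inner ℝ v ((∑ y ∈ T, y) - ∑ x ∈ S, x) := by
    rw [inner_sub_right, inner_sum, inner_sum, Finset.sum_congr rfl hvT, Finset.sum_const, hTK]
    have := Finset.sum_le_card_nsmul S _ _ hvS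
    rw [hSK] at this
    simp only [nsmul_eq_mul] at this ⊢
    linarith
  have e6 := e5.trans (real_inner_le_norm _ _)
  rw [hv, one_mul] at e6
  have hK0 : (0 : ℝ) ≤ K := Nat.cast_nonneg K
  have e7 : (2 * α * K) ^ 2 ≤ 2 * K * (1 - α) := by
    rw [← e4]
    exact pow_le_pow_left₀ (by positivity) e6 2
  have hK1 : (0 : ℝ) < K := by
    by_contra! h
    nlinarith
  have e8 : K * (2 * α ^ 2 * K) ≤ K * (1 - α) := by nlinarith
  have := le_of_mul_le_mul_left e8 hK1
  linarith

/-- In a code all of whose members have inner product close to `α` with a fixed vector `y` of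
square norm close to `α`, negative neighbourhoods contain no large sets with all inner products
`α`. -/
theorem not_large_independent_negative {J : Finset E} {v y : E} {α : ℝ} (hα0 : 0 < α)
    (hα1 : α < 1) (h1 : ∀ x ∈ J, ‖x‖ = 1) (hJ : ∀ x ∈ J, ∀ y ∈ J, x ≠ y → inner ℝ x y = α)
    (hJt : 4 ≤ α ^ 2 * J.card) (hv : ‖v‖ = 1) (hvJ : ∀ x ∈ J, inner ℝ v x ≤ -α)
    (hy : ‖y‖ ^ 2 ≤ α + α ^ 2 / 4) (hvy : α - α ^ 2 / 4 ≤ inner ℝ v y)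
    (hJy : ∀ x ∈ J, α - α ^ 2 / 4 ≤ inner ℝ x y) : False := by
  set t : ℝ := (J.card : ℝ) with ht
  have ht0 : 0 < t := by
    by_contra! h
    nlinarith [sq_nonneg α]
  set s := ∑ x ∈ J, x with hs
  have e1 : ‖s‖ ^ 2 = t * (1 - α) + α * t ^ 2 := norm_sum_sq_eq h1 hJ
  have e2 : t * (α - α ^ 2 / 4) ≤ inner ℝ s y := by
    rw [hs, sum_inner]
    have := Finset.card_nsmul_le_sum J _ _ hJy
    rwa [nsmul_eq_mul] at this
  have e3 : inner ℝ v s ≤ t * (-α) := by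
    rw [hs, inner_sum]
    have := Finset.sum_le_card_nsmul J _ _ hvJ
    rwa [nsmul_eq_mul] at this
  -- The terms of order α cancel, and the errors α²/4, 2·α²/4 and α²/4 add up to α². Against this,
  -- `v` has inner product about 2αt with the same vector.
  have e4 : ‖t • y - s‖ ^ 2 ≤ (t * α) ^ 2 := by
    rw [norm_sub_sq_real, norm_smul, e1, inner_smul_left, real_inner_comm, mul_pow,
      Real.norm_eq_abs, sq_abs, conj_trivial]
    have h2 : t ^ 2 * ‖y‖ ^ 2 ≤ t ^ 2 * (α + α ^ 2 / 4) := by gcongr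
    have h3 : t * (t * (α - α ^ 2 / 4)) ≤ t * inner ℝ s y := by gcongr
    have h4 : t * (1 - α) ≤ t * (α ^ 2 * t / 4) := by gcongr; linarith
    nlinarith
  have e5 : t * (2 * α - α ^ 2 / 4) ≤ inner ℝ v (t • y - s) := by
    rw [inner_sub_right, inner_smul_right]
    have : t * (α - α ^ 2 / 4) ≤ t * inner ℝ v y := by gcongr
    linarith
  have e6 := e5.trans (real_inner_le_norm _ _)
  rw [hv, one_mul] at e6
  have e7 : ‖t • y - s‖ ≤ t * α := abs_le_of_sq_le_sq' e4 (by positivity) |>.2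
  have e8 := le_of_mul_le_mul_left (e6.trans e7) ht0
  nlinarith

end Clusters

/-! ### Splitting a code into two clusters -/

section Main

theorem exists_finset_code_card_le {α : ℝ} (hα0 : 0 < α) (hα1 : α < 1) :
    ∃ d₀ : ℕ, 1 ≤ d₀ ∧ ∀ d : ℕ, d₀ ≤ d → ∀ C : Finset (EuclideanSpace ℝ (Fin d)),
      (∀ x ∈ C, ‖x‖ = 1) → (∀ x ∈ C, ∀ y ∈ C, x ≠ y → inner ℝ x y = α ∨ inner ℝ x y ≤ -α) →
      C.card ≤ 4 * (d - 1) := by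
  obtain ⟨p, hp⟩ := exists_nat_gt ((1 + α) / α)
  rw [div_lt_iff₀ hα0] at hp
  obtain ⟨K, hK⟩ := exists_nat_gt (1 / (2 * α ^ 2))
  rw [div_lt_iff₀ (by positivity)] at hK
  -- Large enough for up to `K` exceptions to shift a mean over `t` vectors by at most α²/4, for
  -- (1-α)/t ≤ α²/4, and for α²t ≥ 4.
  obtain ⟨t, ht⟩ := exists_nat_gt ((2 * K + 1) / (α ^ 2 / 4))
  rw [div_lt_iff₀ (by positivity)] at ht
  obtain ⟨R, hR⟩ := exists_clique_or_independent p t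
  obtain ⟨D, hD⟩ := exists_card_le_of_bounded_degree hα0 hα1 R
  have hK0 : (0 : ℝ) ≤ K := Nat.cast_nonneg K
  have ht0 : (0 : ℝ) < t := by
    by_contra! h
    nlinarith [sq_nonneg α]
  refine ⟨D + R + 2, by omega, fun d hd C h1 hC => ?_⟩
  classical
  have hind : ∀ S ⊆ C, R ≤ S.card → ∃ I ⊆ S, I.card = t ∧
      ∀ x ∈ I, ∀ y ∈ I, x ≠ y → inner ℝ x y = α := by
    intro S hS hRS
    rcases hR (fun x y : EuclideanSpace ℝ (Fin d) => inner ℝ x y ≤ -α)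
      (fun x y h => by rwa [real_inner_comm]) S hRS with ⟨Q, hQS, hQp, hQ⟩ | ⟨I, hIS, hIt, hI⟩
    · have := mul_card_le_of_negative hα0.le (fun x hx => h1 x (hS (hQS hx))) hQ
      rw [hQp] at this
      linarith
    · exact ⟨I, hIS, hIt, fun x hx y hy hxy =>
        (hC x (hS (hIS hx)) y (hS (hIS hy)) hxy).resolve_right (hI x hx y hy hxy)⟩
  rcases Nat.lt_or_ge C.card R with hlt | hge
  · omega
  obtain ⟨I, hIC, hIt, hI⟩ := hind C subset_rfl hge
  set s := ∑ x ∈ I, x with hs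
  set y := (t : ℝ)⁻¹ • s with hy
  have hy2 : ‖y‖ ^ 2 ≤ α + α ^ 2 / 4 := by
    rw [hy, norm_smul, mul_pow, norm_sum_sq_eq (fun x hx => h1 x (hIC hx)) hI, hIt, norm_inv,
      Real.norm_eq_abs, abs_of_pos ht0]
    have : ((t : ℝ)⁻¹) ^ 2 * (t * (1 - α) + α * (t : ℝ) ^ 2) = α + (1 - α) / t := by
      field_simp
      ring
    rw [this]
    have : (1 - α) / t ≤ α ^ 2 / 4 := by
      rw [div_le_iff₀ ht0]
      linarith
    linarith
  have hinner (v : EuclideanSpace ℝ (Fin d)) : inner ℝ v y = (∑ x ∈ I, inner ℝ v x) / t := by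
    rw [hy, inner_smul_right, hs, inner_sum, inv_mul_eq_div]
  have habs : ∀ v ∈ C, ∀ x ∈ I, |inner ℝ v x| ≤ 1 := by
    intro v hv x hx
    have := abs_real_inner_le_norm v x
    rwa [h1 v hv, h1 x (hIC hx), one_mul] at this
  have hmean {a : ℝ} (ha : α * I.card - 2 * K ≤ a) : α - α ^ 2 / 4 ≤ a / t := by
    rw [le_div_iff₀ ht0]
    rw [hIt] at ha
    nlinarith
  have hcover : ∀ v ∈ C, α - α ^ 2 / 4 ≤ inner ℝ v y ∨ α - α ^ 2 / 4 ≤ inner ℝ v (-y) := by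
    intro v hv
    set S := I.filter fun x => inner ℝ v x ≤ -α
    set T := I.filter fun x => inner ℝ v x = α
    rcases Nat.lt_or_ge S.card K with hSK | hSK
    · left
      rw [hinner]
      refine hmean (sub_le_sum_of_few_exceptions hα1.le
        (fun x hx => (abs_le.1 (habs v hv x hx)).1) (Finset.filter_subset _ _) hSK.le
        fun x hx hxS => ?_)
      by_cases hvx : v = x
      · rw [← hvx, real_inner_self_eq_norm_sq, h1 v hv, one_pow]
        exact hα1.le
      · exact ((hC v hv x (hIC hx) hvx).resolve_right fun h =>
          hxS (Finset.mem_filter.2 ⟨hx, h⟩)).ge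
    · have hTK : T.card < K := by
        by_contra! hTK
        obtain ⟨S', hS', hSc⟩ := Finset.exists_subset_card_eq hSK
        obtain ⟨T', hT', hTc⟩ := Finset.exists_subset_card_eq hTK
        exact not_both_large hα0 (fun x hx => h1 x (hIC hx)) hI (h1 v hv) (by linarith)
          (hS'.trans (Finset.filter_subset _ _)) (hT'.trans (Finset.filter_subset _ _)) hSc hTc
          (fun x hx => (Finset.mem_filter.1 (hS' hx)).2)
          (fun x hx => (Finset.mem_filter.1 (hT' hx)).2)
      right
      rw [inner_neg_right, hinner, ← neg_div, ← Finset.sum_neg_distrib]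
      -- If `v` lies in `I`, its inner product 1 with itself is one more exception; strictness of
      -- `hTK` leaves room for it.
      refine hmean (sub_le_sum_of_few_exceptions (N := I.filter fun x => x = v ∨ inner ℝ v x = α)
        hα1.le (fun x hx => neg_le_neg (abs_le.1 (habs v hv x hx)).2) (Finset.filter_subset _ _) ?_
        fun x hx hxT => ?_)
      · have : (I.filter fun x => x = v ∨ inner ℝ v x = α) ⊆ insert v T := by
          intro x hx
          obtain ⟨hxI, hx'⟩ := Finset.mem_filter.1 hx
          rcases hx' with hx' | hx'
          · exact Finset.mem_insert.2 (Or.inl hx')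
          · exact Finset.mem_insert_of_mem (Finset.mem_filter.2 ⟨hxI, hx'⟩)
        exact (Finset.card_le_card this).trans ((Finset.card_insert_le _ _).trans hTK)
      · simp only [Finset.mem_filter, not_and, not_or] at hxT
        obtain ⟨hxv, hxα⟩ := hxT hx
        linarith [(hC v hv x (hIC hx) (Ne.symm hxv)).resolve_left hxα]
  have hcluster : ∀ z : EuclideanSpace ℝ (Fin d), ‖z‖ ^ 2 ≤ α + α ^ 2 / 4 →
      (C.filter fun v => α - α ^ 2 / 4 ≤ inner ℝ v z).card ≤ 2 * (d - 1) := by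
    intro z hz
    set P := C.filter fun v => α - α ^ 2 / 4 ≤ inner ℝ v z with hP
    have hPC : ∀ x ∈ P, x ∈ C ∧ α - α ^ 2 / 4 ≤ inner ℝ x z := fun x hx => Finset.mem_filter.1 hx
    rw [← Fintype.card_coe]
    refine hD d P (fun x => x) (by omega) (fun x => h1 x (hPC x x.2).1)
      (fun x x' h => hC x (hPC x x.2).1 x' (hPC x' x'.2).1 fun h' => h (Subtype.ext h'))
      fun x N hN => ?_
    by_contra! hlt
    have hN' : ∀ w ∈ N.map (Function.Embedding.subtype _),
        w ∈ P ∧ inner ℝ (x : EuclideanSpace ℝ (Fin d)) w ≤ -α := by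
      intro w hw
      obtain ⟨w', hw', rfl⟩ := Finset.mem_map.1 hw
      exact ⟨w'.2, hN w' hw'⟩
    obtain ⟨J, hJN, hJt, hJ⟩ := hind (N.map (Function.Embedding.subtype _))
      (fun w hw => (hPC w (hN' w hw).1).1) (by rw [Finset.card_map]; exact hlt.le)
    refine not_large_independent_negative hα0 hα1
      (fun w hw => h1 w (hPC w (hN' w (hJN hw)).1).1) hJ ?_ (h1 x (hPC x x.2).1)
      (fun w hw => (hN' w (hJN hw)).2) hz (hPC x x.2).2 (fun w hw => (hPC w (hN' w (hJN hw)).1).2)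
    rw [hJt]
    linarith
  have hsub : C ⊆ (C.filter fun v => α - α ^ 2 / 4 ≤ inner ℝ v y) ∪
      C.filter fun v => α - α ^ 2 / 4 ≤ inner ℝ v (-y) := by
    intro v hv
    rw [← Finset.filter_or]
    exact Finset.mem_filter.2 ⟨hv, hcover v hv⟩
  have hc := (Finset.card_le_card hsub).trans (Finset.card_union_le _ _)
  have c1 := hcluster y hy2
  have c2 := hcluster (-y) (by rwa [norm_neg])
  omega

end Main

theorem mainTheorem7 (α : ℝ) (hα : α ∈ Set.Ioo (0 : ℝ) 1) :
    ∃ d₀ : ℕ, 1 ≤ d₀ ∧ ∀ d : ℕ, d₀ ≤ d →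
      maxCodeSize (Set.Icc (-1) (-α) ∪ {α}) d ≤ ((4 * (d - 1) : ℕ) : ℕ∞) := by
  obtain ⟨d₀, hd₀, h⟩ := exists_finset_code_card_le hα.1 hα.2
  refine ⟨d₀, hd₀, fun d hd => iSup₂_le fun C hC => ?_⟩
  by_contra! hlt
  -- A subset of exactly 4(d-1) + 1 elements reduces infinite codes to finite ones.
  obtain ⟨F, hFC, hF⟩ := Set.exists_subset_encard_eq (Order.add_one_le_of_lt hlt)
  have hfin : F.Finite := Set.finite_of_encard_eq_coe (k := 4 * (d - 1) + 1) (by rw [hF]; rfl)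
  have hle := h d hd hfin.toFinset (fun x hx => hC.norm_eq_one x (hFC (hfin.mem_toFinset.1 hx)))
    fun x hx y hy hxy => by
      rcases hC.inner_mem x (hFC (hfin.mem_toFinset.1 hx)) y (hFC (hfin.mem_toFinset.1 hy)) hxy
        with h' | h'
      exacts [Or.inr h'.2, Or.inl h']
  rw [hfin.encard_eq_coe_toFinset_card] at hF
  have : hfin.toFinset.card = 4 * (d - 1) + 1 := by exact_mod_cast hF
  omega
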